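/- **Setting.** Let $k\ge 1$ and let $X_\theta\sim\mathcal N\big((\mu_1,\dots,\mu_k),\operatorname{diag}(\sigma_1^2,\dots,\sigma_k^2)\big)$ with parameter $\theta=(\mu_1,\dots,\mu_k,\sigma_1,\dots,\sigma_k)$, $\sigma_j\ge 0$. The secrets $g_1(\theta),\dots,g_d(\theta)$ are $d$ distinct coordinates of $\theta$ (so $d\le 2k$), with tolerances $\epsilon_i>0$. Let $\theta$ be random with prior law $P$. A release mechanism $\mathcal M$ is a Markov kernel $\theta\mapsto\theta'\sim\mathcal M(\theta)$ on the parameters. Its intersection privacy is $$\Pi^{\mathrm{inter}}(\mathcal M)=\sup_{\hat g}\ \mathbb P\Big(\bigcap_{i=1}^d\big\{|\hat g_i(\theta')-g_i(\theta)|\le\epsilon_i\big\}\Big),$$ where the supremum is over all (possibly randomized) attacker strategies $\hat g=(\hat g_1,\dots,\hat g_d)$ depending on the released $\theta'$ only, and the probability is over $\theta\sim P$, $\mathcal M$ and $\hat g$. Its distortion is $$\Delta_{\mathcal M}=\sup_{\theta\in\operatorname{supp}P,\ \theta'\in\operatorname{supp}\mathcal M(\theta)}W_2\big(\mathrm{Law}(X_\theta),\mathrm{Law}(X_{\theta'})\big),$$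 with $W_2$ the Wasserstein-2 distance. For a budget $T$, let $\Delta_{opt}(T)=\inf\{\Delta_{\mathcal M}:\Pi^{\mathrm{inter}}(\mathcal M)\le T\}$. **Mechanism.** Given lower bounds $\underline{g_i}$ of the secrets and interval lengths $s_{g_i}$, the quantization mechanism $\mathcal M_{\mathrm{Alg.1}}$ releases, for each $i$, $g_i'(\theta)=\underline{g_i}+\big\lfloor (g_i(\theta)-\underline{g_i})/s_{g_i}\big\rfloor s_{g_i}+U_i$ in place of $g_i(\theta)$, with independent $U_i$ uniform on $(0,s_{g_i})$, and leaves the non-secret parameters unchanged. **Proposition.** Let $s_{g_i}\ge 2\epsilon_i>0$ for $i=1,\dots,d$. There is a constant $c_{\epsilon,s}>0$ depending only on $(\epsilon_i)_i$ and $(s_{g_i})_i$ such that the following holds for every $k$, every choice of secrets and every prior $P$ for which the secret parameters are mutually independent, jointly independent of the non-secret parameters, and each $g_i(\theta)$ is uniform on $[\underline{g_i},\underline{g_i}+N_is_{g_i}]$ for some integer $N_i\ge1$: $$\Pi^{\mathrm{inter}}(\mathcal M_{\mathrm{Alg.1}})=\prod_{i=1}^d\frac{2\epsilon_i}{s_{g_i}},\qquad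 \Delta_{\mathcal M_{\mathrm{Alg.1}}}=\sqrt{\sum_{i=1}^d s_{g_i}^2},$$ and, if moreover $\prod_{i=1}^d 2\epsilon_i/s_{g_i}<1$, $$\Delta_{\mathcal M_{\mathrm{Alg.1}}}<c_{\epsilon,s}\cdot\Delta_{opt}\big(\Pi^{\mathrm{inter}}(\mathcal M_{\mathrm{Alg.1}})\big).$$ -/

import Mathlib

open MeasureTheory ProbabilityTheory
open scoped ENNReal

namespace SummaryPrivacy

/-- Parameters `θ = (μ₁, …, μₖ, σ₁, …, σₖ)` of a `k`-dimensional Gaussian with independent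
coordinates: `θ (Sum.inl j)` is the mean `μⱼ` and `θ (Sum.inr j)` the standard deviation `σⱼ`. -/
abbrev Param (k : ℕ) : Type := Fin k ⊕ Fin k → ℝ

/-- The data distribution with parameter `θ`: the Gaussian on `ℝᵏ` with mean `(μ₁, …, μₖ)` and
covariance matrix `diag(σ₁², …, σₖ²)`. -/
noncomputable def gaussianLaw {k : ℕ} (θ : Param k) : Measure (EuclideanSpace ℝ (Fin k)) :=
  multivariateGaussian (WithLp.toLp 2 fun j => θ (Sum.inl j))
    (Matrix.diagonal fun j => θ (Sum.inr j) ^ 2)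

/-- The Wasserstein-2 distance: the square root of the infimum of `∫ d(x, y)² dπ(x, y)` over all
couplings `π` of `μ` and `ν`. -/
noncomputable def wasserstein2 {E : Type*} [PseudoEMetricSpace E] [MeasurableSpace E]
    (μ ν : Measure E) : ℝ≥0∞ :=
  (⨅ (π : Measure (E × E)) (_ : π.map Prod.fst = μ ∧ π.map Prod.snd = ν),
    ∫⁻ z, edist z.1 z.2 ^ 2 ∂π) ^ (1 / 2 : ℝ)

/-- Intersection privacy of a release mechanism `M` under the prior `P`, for the secrets
`gᵢ(θ) = θ (g i)` and the tolerances `ε i`: the supremum, over all (possibly randomized) attacker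
strategies `A`, of the probability that the guess made from the released parameter `θ'` is within
`ε i` of `gᵢ(θ)` for all `i` at once. A sample point is `((θ, θ'), guess)`. -/
noncomputable def interPrivacy {k d : ℕ} (P : Measure (Param k)) (g : Fin d ↪ Fin k ⊕ Fin k)
    (ε : Fin d → ℝ) (M : Kernel (Param k) (Param k)) : ℝ≥0∞ :=
  ⨆ (A : Kernel (Param k) (Fin d → ℝ)) (_ : IsMarkovKernel A),
    ((P ⊗ₘ M) ⊗ₘ A.prodMkLeft (Param k)) {z | ∀ i, |z.2 i - z.1.1 (g i)| ≤ ε i}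

/-- Distortion of a release mechanism `M` under the prior `P`: the worst-case Wasserstein-2
distance between the original and the released data distribution. -/
noncomputable def distortion {k : ℕ} (P : Measure (Param k)) (M : Kernel (Param k) (Param k)) :
    ℝ≥0∞ :=
  ⨆ θ ∈ P.support, ⨆ θ' ∈ (M θ).support, wasserstein2 (gaussianLaw θ) (gaussianLaw θ')

/-- The optimal achievable distortion under the intersection privacy budget `T`: the infimum of
the distortion over all release mechanisms whose intersection privacy is at most `T`. -/
noncomputable def optDistortion {k d : ℕ} (P : Measure (Param k)) (g : Fin d ↪ Fin k ⊕ Fin k)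
    (ε : Fin d → ℝ) (T : ℝ≥0∞) : ℝ≥0∞ :=
  ⨅ (M : Kernel (Param k) (Param k)) (_ : IsMarkovKernel M) (_ : interPrivacy P g ε M ≤ T),
    distortion P M

/-- The uniform distribution on the interval from `a` to `b`. -/
noncomputable def uniformLaw (a b : ℝ) : Measure ℝ := cond volume (Set.Icc a b)

/-- The parameter released by the quantization mechanism when its internal randomness is `u`: the
`i`-th secret parameter becomes `lo i + ⌊(gᵢ(θ) - lo i) / s i⌋ * s i + u i`, and the non-secret
parameters keep their values. -/
noncomputable def quantize {k d : ℕ} (g : Fin d ↪ Fin k ⊕ Fin k) (lo s : Fin d → ℝ)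
    (θ : Param k) (u : Fin d → ℝ) : Param k :=
  Function.extend g (fun i => lo i + ⌊(θ (g i) - lo i) / s i⌋ * s i + u i) θ

theorem measurable_quantize {k d : ℕ} (g : Fin d ↪ Fin k ⊕ Fin k) (lo s : Fin d → ℝ) :
    Measurable fun z : Param k × (Fin d → ℝ) => quantize g lo s z.1 z.2 := by
  refine measurable_pi_iff.2 fun c => ?_
  by_cases hc : ∃ i, g i = c
  · obtain ⟨i, rfl⟩ := hc
    simp only [quantize, g.injective.extend_apply]
    fun_prop
  · simp only [quantize, Function.extend_apply' _ _ _ hc]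
    fun_prop

/-- The quantization release mechanism, with `u i` drawn independently and uniformly
from `(0, s i)`. -/
noncomputable def quantMechanism {k d : ℕ} (g : Fin d ↪ Fin k ⊕ Fin k) (lo s : Fin d → ℝ) :
    Kernel (Param k) (Param k) :=
  (Kernel.id ×ₖ Kernel.const (Param k) (Measure.pi fun i => uniformLaw 0 (s i))).map
    fun z => quantize g lo s z.1 z.2

end SummaryPrivacy

namespace SummaryPrivacy

/-! ### Wasserstein distance between Gaussians with independent coordinates -/

/-! For Gaussians with diagonal covariance, `W₂` is the Euclidean distance between the parameters,
standard deviations taken in absolute value (`wasserstein2_gaussianLaw`). Driving both laws by one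
standard Gaussian attains this value, and no coupling does better in any single coordinate.
Distortion thus becomes Euclidean geometry in parameter space.

Privacy: the released secret is a bin plus noise independent of `θ`, so even an attacker who knows
the noise and the non-secret parameters learns only the bins. Given its bin, a secret is uniform on
length `s i`, and a guess covers at most `2 * ε i` of it; independence multiplies these fractions
(`lintegral_guess_le`, `interPrivacy_quantMechanism_le`). Conversely, the bins can be read off the
release, and guessing their midpoints attains the product (`le_interPrivacy_quantMechanism`).

Distortion: a secret moves by at most `s i`, and by nearly `s i` when it lies near the left end of
its bin while the noise is near `s i`, for all `i` at once.

Optimality: if the distortion is below every tolerance, the release itself is a successful guess and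
privacy is `1`. A budget below `1` therefore forces distortion at least `min ε`, and a ratio
depending only on `ε` and `s` bounds the gap (`le_optDistortion`). -/

open scoped MatrixOrder in
theorem sqrt_diagonal_sq {k : ℕ} (v : Fin k → ℝ) :
    CFC.sqrt (Matrix.diagonal fun j => v j ^ 2) = Matrix.diagonal fun j => |v j| := by
  refine CFC.sqrt_unique ?_ ?_
  · simp [Matrix.diagonal_mul_diagonal, sq]
  · rw [Matrix.nonneg_iff_posSemidef, Matrix.posSemidef_diagonal_iff]
    exact fun j => abs_nonneg _

theorem posSemidef_diagonal_sq {k : ℕ} (v : Fin k → ℝ) :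
    (Matrix.diagonal fun j => v j ^ 2).PosSemidef :=
  Matrix.posSemidef_diagonal_iff.2 fun _ => sq_nonneg _

instance {k : ℕ} (θ : Param k) : IsGaussian (gaussianLaw θ) := by
  unfold gaussianLaw; infer_instance

/-- The Gaussian transport map from the standard Gaussian. -/
noncomputable def gaussianTransport {k : ℕ} (θ : Param k) (x : EuclideanSpace ℝ (Fin k)) :
    EuclideanSpace ℝ (Fin k) :=
  WithLp.toLp 2 fun j => θ (Sum.inl j) + |θ (Sum.inr j)| * x j

theorem measurable_gaussianTransport {k : ℕ} (θ : Param k) :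
    Measurable (gaussianTransport θ) := by
  unfold gaussianTransport; fun_prop

theorem gaussianLaw_eq_map {k : ℕ} (θ : Param k) :
    gaussianLaw θ = (stdGaussian (EuclideanSpace ℝ (Fin k))).map (gaussianTransport θ) := by
  unfold gaussianLaw multivariateGaussian
  congr 1
  ext x j
  simp [sqrt_diagonal_sq, gaussianTransport, Matrix.mulVec_diagonal]

/-- Cauchy–Schwarz: the variance of `X - t • Y` is a quadratic in `t` that is never negative, so its
discriminant is at most zero. -/
theorem covariance_le_of_variance_eq {Ω : Type*} {mΩ : MeasurableSpace Ω} {π : Measure Ω}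
    [IsProbabilityMeasure π] {X Y : Ω → ℝ} (hX : MemLp X 2 π) (hY : MemLp Y 2 π) {a b : ℝ}
    (ha : 0 ≤ a) (hb : 0 ≤ b) (hXa : Var[X; π] = a ^ 2) (hYb : Var[Y; π] = b ^ 2) :
    cov[X, Y; π] ≤ a * b := by
  have h : ∀ t : ℝ, 0 ≤ b ^ 2 * (t * t) + (-2 * cov[X, Y; π]) * t + a ^ 2 := by
    intro t
    have h0 := variance_nonneg (X - t • Y) π
    rw [variance_sub hX (hY.const_smul t), variance_smul, covariance_smul_right, hXa, hYb] at h0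
    nlinarith
  have hd := discrim_le_zero h
  rw [discrim] at hd
  exact le_of_abs_le (abs_le_of_sq_le_sq (by nlinarith) (by positivity))

theorem lintegral_sub_sq_eq {Ω : Type*} {mΩ : MeasurableSpace Ω} {π : Measure Ω}
    [IsProbabilityMeasure π] {X Y : Ω → ℝ} (hX : MemLp X 2 π) (hY : MemLp Y 2 π) :
    ∫⁻ ω, ENNReal.ofReal ((X ω - Y ω) ^ 2) ∂π
      = ENNReal.ofReal ((π[X] - π[Y]) ^ 2 + Var[X - Y; π]) := by
  have h := ofReal_integral_eq_lintegral_ofReal (hX.sub hY).integrable_sq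
    (ae_of_all _ fun _ => sq_nonneg _)
  simp only [Pi.sub_apply] at h
  have hE : ∫ ω, (X - Y) ω ∂π = ∫ ω, X ω ∂π - ∫ ω, Y ω ∂π :=
    integral_sub (hX.integrable one_le_two) (hY.integrable one_le_two)
  rw [← h, variance_eq_sub (hX.sub hY), hE]
  simp

theorem lintegral_affine_sq {Ω : Type*} {mΩ : MeasurableSpace Ω} {π : Measure Ω}
    [IsProbabilityMeasure π] {Z : Ω → ℝ} (hZ : MemLp Z 2 π) (hE : π[Z] = 0) (hV : Var[Z; π] = 1)
    (p q : ℝ) :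
    ∫⁻ ω, ENNReal.ofReal ((p + q * Z ω) ^ 2) ∂π = ENNReal.ofReal (p ^ 2 + q ^ 2) := by
  have hqZ : MemLp (fun ω => q * Z ω) 2 π := hZ.const_mul q
  have h := lintegral_sub_sq_eq hqZ (memLp_const (-p))
  have hsub : ((fun ω => q * Z ω) - fun _ => -p) = fun ω => p + q * Z ω := by
    ext ω; simp only [Pi.sub_apply]; ring
  rw [hsub, variance_const_add hqZ.aestronglyMeasurable, variance_const_mul, hV,
    integral_const_mul, hE] at h
  simpa [add_comm] using h

/-- Split the second moment into squared mean plus variance; the covariance is the only term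
depending on the coupling, and Cauchy–Schwarz caps it at `a * b`. -/
theorem lintegral_sub_sq_ge {Ω : Type*} {mΩ : MeasurableSpace Ω} {π : Measure Ω}
    [IsProbabilityMeasure π] {X Y : Ω → ℝ} (hX : MemLp X 2 π) (hY : MemLp Y 2 π) {a b : ℝ}
    (ha : 0 ≤ a) (hb : 0 ≤ b) (hXa : Var[X; π] = a ^ 2) (hYb : Var[Y; π] = b ^ 2) :
    ENNReal.ofReal ((π[X] - π[Y]) ^ 2 + (a - b) ^ 2)
      ≤ ∫⁻ ω, ENNReal.ofReal ((X ω - Y ω) ^ 2) ∂π := by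
  rw [lintegral_sub_sq_eq hX hY, variance_sub hX hY, hXa, hYb]
  have := covariance_le_of_variance_eq hX hY ha hb hXa hYb
  exact ENNReal.ofReal_le_ofReal (by nlinarith)

theorem edist_sq_eq_sum {k : ℕ} (x y : EuclideanSpace ℝ (Fin k)) :
    edist x y ^ 2 = ∑ j, ENNReal.ofReal ((x j - y j) ^ 2) := by
  rw [edist_dist, ← ENNReal.ofReal_pow dist_nonneg, EuclideanSpace.dist_eq,
    Real.sq_sqrt (Finset.sum_nonneg fun _ _ => sq_nonneg _),
    ENNReal.ofReal_sum_of_nonneg fun _ _ => sq_nonneg _]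
  simp [Real.dist_eq]

theorem lintegral_edist_sq {k : ℕ}
    (π : Measure (EuclideanSpace ℝ (Fin k) × EuclideanSpace ℝ (Fin k))) :
    ∫⁻ z, edist z.1 z.2 ^ 2 ∂π = ∑ j, ∫⁻ z, ENNReal.ofReal ((z.1 j - z.2 j) ^ 2) ∂π := by
  simp_rw [edist_sq_eq_sum]
  exact lintegral_finsetSum _ fun j _ => by fun_prop

/-- The parameter with the standard deviations replaced by their absolute values; it determines
the same Gaussian. -/
noncomputable def absDev {k : ℕ} (θ : Param k) : Param k :=
  Sum.elim (fun j => θ (Sum.inl j)) fun j => |θ (Sum.inr j)|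

theorem abs_absDev_sub_le {k : ℕ} (θ θ' : Param k) (c : Fin k ⊕ Fin k) :
    |absDev θ c - absDev θ' c| ≤ |θ c - θ' c| := by
  rcases c with j | j
  · simp [absDev]
  · simpa [absDev] using abs_abs_sub_abs_le _ _

theorem memLp_eval_gaussianLaw {k : ℕ} (θ : Param k) (j : Fin k) :
    MemLp (fun x : EuclideanSpace ℝ (Fin k) => x j) 2 (gaussianLaw θ) := by
  have h := measurePreserving_eval_multivariateGaussian
    (μ := WithLp.toLp 2 fun j => θ (Sum.inl j))
    (posSemidef_diagonal_sq fun j => θ (Sum.inr j)) (i := j)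
  exact (memLp_id_gaussianReal' 2 (by simp)).comp_measurePreserving h

theorem integral_eval_gaussianLaw {k : ℕ} (θ : Param k) (j : Fin k) :
    ∫ x, x j ∂(gaussianLaw θ) = θ (Sum.inl j) := by
  have h := measurePreserving_eval_multivariateGaussian
    (μ := WithLp.toLp 2 fun j => θ (Sum.inl j))
    (posSemidef_diagonal_sq fun j => θ (Sum.inr j)) (i := j)
  have h' := integral_map (f := id) (μ := gaussianLaw θ) h.measurable.aemeasurable
    measurable_id.aestronglyMeasurable
  rw [gaussianLaw, h.map_eq] at h'
  rw [gaussianLaw]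
  simpa using h'.symm

theorem variance_eval_gaussianLaw {k : ℕ} (θ : Param k) (j : Fin k) :
    Var[fun x => x j; gaussianLaw θ] = |θ (Sum.inr j)| ^ 2 := by
  rw [gaussianLaw, variance_eval_multivariateGaussian (posSemidef_diagonal_sq _)]
  simp

theorem stdGaussian_eq_gaussianLaw (k : ℕ) :
    stdGaussian (EuclideanSpace ℝ (Fin k)) = gaussianLaw (Sum.elim 0 1 : Param k) := by
  simp only [gaussianLaw, ← multivariateGaussian_zero_one, Sum.elim_inl, Sum.elim_inr]
  congr 1
  simp

theorem gaussianTransport_apply {k : ℕ} (θ : Param k) (x : EuclideanSpace ℝ (Fin k))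
    (j : Fin k) : gaussianTransport θ x j = θ (Sum.inl j) + |θ (Sum.inr j)| * x j := rfl

theorem lintegral_gaussianTransport_sub_sq {k : ℕ} (θ θ' : Param k) (j : Fin k) :
    ∫⁻ x, ENNReal.ofReal ((gaussianTransport θ x j - gaussianTransport θ' x j) ^ 2)
        ∂stdGaussian (EuclideanSpace ℝ (Fin k))
      = ENNReal.ofReal ((θ (Sum.inl j) - θ' (Sum.inl j)) ^ 2
        + (|θ (Sum.inr j)| - |θ' (Sum.inr j)|) ^ 2) := by
  rw [stdGaussian_eq_gaussianLaw]
  have hrw : ∀ x, gaussianTransport θ x j - gaussianTransport θ' x j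
      = (θ (Sum.inl j) - θ' (Sum.inl j)) + (|θ (Sum.inr j)| - |θ' (Sum.inr j)|) * x j := by
    intro x; rw [gaussianTransport_apply, gaussianTransport_apply]; ring
  simp_rw [hrw]
  exact lintegral_affine_sq (memLp_eval_gaussianLaw _ j)
    (by rw [integral_eval_gaussianLaw]; simp) (by rw [variance_eval_gaussianLaw]; simp) _ _

theorem wasserstein2_gaussianLaw {k : ℕ} (θ θ' : Param k) :
    wasserstein2 (gaussianLaw θ) (gaussianLaw θ')
      = ENNReal.ofReal (√(∑ c, (absDev θ c - absDev θ' c) ^ 2)) := by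
  have hsplit : ∑ c, (absDev θ c - absDev θ' c) ^ 2
      = ∑ j, ((θ (Sum.inl j) - θ' (Sum.inl j)) ^ 2
        + (|θ (Sum.inr j)| - |θ' (Sum.inr j)|) ^ 2) := by
    simp [Fintype.sum_sum_type, absDev, Finset.sum_add_distrib]
  rw [wasserstein2, Real.sqrt_eq_rpow,
    ← ENNReal.ofReal_rpow_of_nonneg (Finset.sum_nonneg fun _ _ => sq_nonneg _) (by norm_num),
    hsplit, ENNReal.ofReal_sum_of_nonneg fun _ _ => by positivity]
  congr 1
  apply le_antisymm
  · set γ := stdGaussian (EuclideanSpace ℝ (Fin k)) with hγ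
    have hm := (measurable_gaussianTransport θ).prodMk (measurable_gaussianTransport θ')
    refine (iInf₂_le (γ.map fun x => (gaussianTransport θ x, gaussianTransport θ' x))
      ⟨?_, ?_⟩).trans ?_
    rotate_left
    · rw [Measure.map_map measurable_fst hm, gaussianLaw_eq_map]; rfl
    · rw [Measure.map_map measurable_snd hm, gaussianLaw_eq_map]; rfl
    rw [lintegral_edist_sq]
    refine Finset.sum_le_sum fun j _ => ?_
    rw [lintegral_map (by fun_prop) hm]
    exact (lintegral_gaussianTransport_sub_sq θ θ' j).le
  · refine le_iInf₂ fun π hπ => ?_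
    rw [lintegral_edist_sq]
    refine Finset.sum_le_sum fun j _ => ?_
    have h1 : MeasurePreserving Prod.fst π (gaussianLaw θ) := ⟨measurable_fst, hπ.1⟩
    have h2 : MeasurePreserving Prod.snd π (gaussianLaw θ') := ⟨measurable_snd, hπ.2⟩
    -- `wasserstein2` ranges over arbitrary measures; total mass one comes from the marginal.
    have : IsProbabilityMeasure π := by
      have := h1.measure_preimage (s := Set.univ) nullMeasurableSet_univ
      exact ⟨by simpa using this⟩
    have hev : Measurable fun x : EuclideanSpace ℝ (Fin k) => x j := by fun_prop
    have e1 : ∫ z, z.1 j ∂π = θ (Sum.inl j) := by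
      rw [← integral_eval_gaussianLaw θ j, ← h1.map_eq, integral_map measurable_fst.aemeasurable
        hev.aestronglyMeasurable]
    have e2 : ∫ z, z.2 j ∂π = θ' (Sum.inl j) := by
      rw [← integral_eval_gaussianLaw θ' j, ← h2.map_eq, integral_map measurable_snd.aemeasurable
        hev.aestronglyMeasurable]
    have v1 : Var[fun z => z.1 j; π] = |θ (Sum.inr j)| ^ 2 := by
      rw [← variance_eval_gaussianLaw, ← h1.map_eq, variance_map hev.aemeasurable
        measurable_fst.aemeasurable]; rfl
    have v2 : Var[fun z => z.2 j; π] = |θ' (Sum.inr j)| ^ 2 := by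
      rw [← variance_eval_gaussianLaw, ← h2.map_eq, variance_map hev.aemeasurable
        measurable_snd.aemeasurable]; rfl
    have := lintegral_sub_sq_ge ((memLp_eval_gaussianLaw θ j).comp_measurePreserving h1)
      ((memLp_eval_gaussianLaw θ' j).comp_measurePreserving h2)
      (abs_nonneg (θ (Sum.inr j))) (abs_nonneg (θ' (Sum.inr j))) v1 v2
    simp only [Function.comp_apply] at this
    rwa [e1, e2] at this

/-! ### Uniform laws and quantization bins -/

theorem setOf_floor_eq {lo s : ℝ} (hs : 0 < s) (n : ℤ) :
    {x : ℝ | ⌊(x - lo) / s⌋ = n} = Set.Ico (lo + n * s) (lo + (n + 1) * s) := by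
  ext x
  simp only [Set.mem_ofPred_eq, Int.floor_eq_iff, Set.mem_Ico, le_div_iff₀ hs, div_lt_iff₀ hs]
  constructor <;> rintro ⟨h1, h2⟩ <;> constructor <;> linarith

theorem uniformLaw_apply (a b : ℝ) (t : Set ℝ) :
    uniformLaw a b t = (ENNReal.ofReal (b - a))⁻¹ * volume (Set.Icc a b ∩ t) := by
  rw [uniformLaw, cond_apply measurableSet_Icc, Real.volume_Icc]

theorem isProbabilityMeasure_uniformLaw {a b : ℝ} (h : a < b) :
    IsProbabilityMeasure (uniformLaw a b) :=
  cond_isProbabilityMeasure_of_finite (by simpa using h) (by simp)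

/-- As the interval is a union of `N` whole bins and its right endpoint, any other bin meets it in
at most the null set `{hi}`. No partial bins need to be treated. -/
theorem uniformLaw_bin {lo hi s : ℝ} (hs : 0 < s) {N : ℕ} (hhi : hi = lo + N * s) (n : ℤ) :
    (0 ≤ n ∧ n < N ∧ Set.Ico (lo + n * s) (lo + (n + 1) * s) ⊆ Set.Icc lo hi ∧
      uniformLaw lo hi {x | ⌊(x - lo) / s⌋ = n}
        = (ENNReal.ofReal (hi - lo))⁻¹ * ENNReal.ofReal s) ∨
      uniformLaw lo hi {x | ⌊(x - lo) / s⌋ = n} = 0 := by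
  rw [uniformLaw_apply, setOf_floor_eq hs]
  by_cases h : 0 ≤ n ∧ n < N
  · left
    have h0 : (0 : ℝ) ≤ n := by exact_mod_cast h.1
    have h1 : (n : ℝ) + 1 ≤ N := by exact_mod_cast h.2
    have hsub : Set.Ico (lo + n * s) (lo + (n + 1) * s) ⊆ Set.Icc lo hi := by
      intro x hx
      have := mul_nonneg h0 hs.le
      have := mul_le_mul_of_nonneg_right h1 hs.le
      exact ⟨by linarith [hx.1], by linarith [hx.2]⟩
    refine ⟨h.1, h.2, hsub, ?_⟩
    rw [Set.inter_eq_right.2 hsub, Real.volume_Ico]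
    congr 2
    ring
  · right
    have : Set.Icc lo hi ∩ Set.Ico (lo + n * s) (lo + (n + 1) * s) ⊆ {hi} := by
      rintro x ⟨hx, hx'⟩
      by_cases hn : 0 ≤ n
      · have h1 : (N : ℝ) ≤ n := by exact_mod_cast not_lt.1 fun hlt => h ⟨hn, hlt⟩
        have := mul_le_mul_of_nonneg_right h1 hs.le
        exact le_antisymm hx.2 (by linarith [hx'.1])
      · have h1 : (n : ℝ) + 1 ≤ 0 := by exact_mod_cast not_le.1 hn
        have := mul_nonpos_of_nonpos_of_nonneg h1 hs.le
        linarith [hx.1, hx'.2]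
    rw [measure_mono_null this (by simp), mul_zero]

theorem uniformLaw_bin_inter_le {lo hi s ε : ℝ} (hs : 0 < s) (hε : 0 < ε) {N : ℕ}
    (hhi : hi = lo + N * s) (n : ℤ) (a : ℝ) :
    uniformLaw lo hi ({x | ⌊(x - lo) / s⌋ = n} ∩ {x | |a - x| ≤ ε})
      ≤ ENNReal.ofReal (2 * ε / s) * uniformLaw lo hi {x | ⌊(x - lo) / s⌋ = n} := by
  rcases uniformLaw_bin hs hhi n with ⟨-, -, -, h⟩ | h
  · rw [h, mul_left_comm, ← ENNReal.ofReal_mul (by positivity), div_mul_cancel₀ _ hs.ne',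
      uniformLaw_apply]
    gcongr
    calc volume (Set.Icc lo hi ∩ ({x | ⌊(x - lo) / s⌋ = n} ∩ {x | |a - x| ≤ ε}))
        ≤ volume (Set.Icc (a - ε) (a + ε)) := by
          refine measure_mono fun x hx => ?_
          have hax : |a - x| ≤ ε := hx.2.2
          have := abs_le.1 hax
          exact ⟨by linarith, by linarith⟩
      _ = ENNReal.ofReal (2 * ε) := by rw [Real.volume_Icc]; congr 1; ring
  · rw [measure_mono_null Set.inter_subset_left h]
    exact zero_le

theorem le_uniformLaw_bin_inter {lo hi s ε : ℝ} (hs : 0 < s) (hε : 0 < ε) (hεs : 2 * ε ≤ s)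
    {N : ℕ} (hhi : hi = lo + N * s) (n : ℤ) :
    ENNReal.ofReal (2 * ε / s) * uniformLaw lo hi {x | ⌊(x - lo) / s⌋ = n}
      ≤ uniformLaw lo hi
        ({x | ⌊(x - lo) / s⌋ = n} ∩ {x | |lo + (⌊(x - lo) / s⌋ + 1 / 2) * s - x| ≤ ε}) := by
  rcases uniformLaw_bin hs hhi n with ⟨-, -, hsub, h⟩ | h
  · rw [h, mul_left_comm, ← ENNReal.ofReal_mul (by positivity), div_mul_cancel₀ _ hs.ne',
      uniformLaw_apply]
    gcongr
    calc ENNReal.ofReal (2 * ε)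
        -- The open window stays inside the half-open bin even when `2 * ε = s`.
        = volume (Set.Ioo (lo + (n + 1 / 2) * s - ε) (lo + (n + 1 / 2) * s + ε)) := by
          rw [Real.volume_Ioo]; congr 1; ring
      _ ≤ _ := by
          refine measure_mono fun x hx => ?_
          have hx' : x ∈ Set.Ico (lo + n * s) (lo + (n + 1) * s) :=
            ⟨by linarith [hx.1], by linarith [hx.2]⟩
          refine ⟨hsub hx', ?_⟩
          rw [← setOf_floor_eq hs] at hx'
          refine ⟨hx', ?_⟩
          simp only [Set.mem_ofPred_eq] at hx' ⊢
          rw [hx', abs_le]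
          exact ⟨by linarith [hx.2], by linarith [hx.1]⟩
  · rw [h, mul_zero]
    exact zero_le

theorem tsum_measure_inter_fiber {α β : Type*} [MeasurableSpace α] [MeasurableSpace β]
    [Countable β] [MeasurableSingletonClass β] (μ : Measure α) {f : α → β} (hf : Measurable f)
    {E : Set α} : ∑' n, μ ({x | f x = n} ∩ E) = μ E := by
  have h := tsum_measure_preimage_singleton (μ := μ.restrict E) (s := Set.univ)
    Set.countable_univ (f := f) fun y _ => hf (measurableSet_singleton y)
  rw [tsum_univ fun b => μ.restrict E (f ⁻¹' {b}), Set.preimage_univ,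
    Measure.restrict_apply_univ] at h
  rw [← h]
  exact tsum_congr fun n => (Measure.restrict_apply (hf (measurableSet_singleton n))).symm

theorem le_uniformLaw_center {lo hi s ε : ℝ} (hs : 0 < s) (hε : 0 < ε) (hεs : 2 * ε ≤ s)
    {N : ℕ} (hN : 0 < N) (hhi : hi = lo + N * s) :
    ENNReal.ofReal (2 * ε / s)
      ≤ uniformLaw lo hi {x | |lo + (⌊(x - lo) / s⌋ + 1 / 2) * s - x| ≤ ε} := by
  have hlt : lo < hi := by rw [hhi]; have : (0 : ℝ) < N := by exact_mod_cast hN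
                           nlinarith [mul_pos this hs]
  have := isProbabilityMeasure_uniformLaw hlt
  have hm : Measurable fun x : ℝ => ⌊(x - lo) / s⌋ := by fun_prop
  rw [← tsum_measure_inter_fiber _ hm]
  calc ENNReal.ofReal (2 * ε / s)
      = ENNReal.ofReal (2 * ε / s) * ∑' n : ℤ, uniformLaw lo hi
          ({x | ⌊(x - lo) / s⌋ = n} ∩ Set.univ) := by
        rw [tsum_measure_inter_fiber _ hm, measure_univ, mul_one]
    _ = ∑' n : ℤ, ENNReal.ofReal (2 * ε / s) * uniformLaw lo hi {x | ⌊(x - lo) / s⌋ = n} := by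
        simp [ENNReal.tsum_mul_left]
    _ ≤ _ := ENNReal.tsum_le_tsum fun n => le_uniformLaw_bin_inter hs hε hεs hhi n

/-- The endpoint `s`, which would push the release into the next bin, is a null set. -/
theorem ae_uniformLaw_mem_Ico {s : ℝ} : ∀ᵐ u ∂uniformLaw 0 s, u ∈ Set.Ico 0 s := by
  rw [ae_iff, uniformLaw_apply, measure_mono_null (t := {s}) _ (by simp), mul_zero]
  rintro x ⟨hx, hx'⟩
  by_contra hne
  exact hx' ⟨hx.1, lt_of_le_of_ne hx.2 hne⟩

theorem uniformLaw_Icc_pos {a b x y : ℝ} (hx : a ≤ x) (hxy : x < y) (hy : y ≤ b) :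
    0 < uniformLaw a b (Set.Icc x y) := by
  rw [uniformLaw_apply, Set.inter_eq_right.2 (Set.Icc_subset_Icc hx hy), Real.volume_Icc]
  exact ENNReal.mul_pos (by simp) (by simpa using hxy)

/-! ### Intersection privacy of the quantization mechanism -/

section Bins

variable {d : ℕ} {ε s lo hi : Fin d → ℝ} {N : Fin d → ℕ}

theorem pi_uniformLaw_bin_inter_le (hs : ∀ i, 0 < s i) (hε : ∀ i, 0 < ε i)
    (hN : ∀ i, 0 < N i) (hhi : ∀ i, hi i = lo i + N i * s i) (n : Fin d → ℤ) (a : Fin d → ℝ) :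
    Measure.pi (fun i => uniformLaw (lo i) (hi i))
        ({x | (fun i => ⌊(x i - lo i) / s i⌋) = n} ∩ {x | ∀ i, |a i - x i| ≤ ε i})
      ≤ ENNReal.ofReal (∏ i, 2 * ε i / s i) * Measure.pi (fun i => uniformLaw (lo i) (hi i))
          {x | (fun i => ⌊(x i - lo i) / s i⌋) = n} := by
  have hlt : ∀ i, lo i < hi i := fun i => by
    have : (0 : ℝ) < N i := by exact_mod_cast hN i
    nlinarith [mul_pos this (hs i), hhi i]
  have := fun i => isProbabilityMeasure_uniformLaw (hlt i)
  have h1 : {x : Fin d → ℝ | (fun i => ⌊(x i - lo i) / s i⌋) = n}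
      = Set.univ.pi fun i => {x | ⌊(x - lo i) / s i⌋ = n i} := by
    ext x; simp [funext_iff]
  have h2 : {x : Fin d → ℝ | ∀ i, |a i - x i| ≤ ε i}
      = Set.univ.pi fun i => {x | |a i - x| ≤ ε i} := by
    ext x; simp
  rw [h1, h2, ← Set.pi_inter_distrib, Measure.pi_pi, Measure.pi_pi,
    ENNReal.ofReal_prod_of_nonneg fun i _ => by have := hs i; have := hε i; positivity,
    ← Finset.prod_mul_distrib]
  exact Finset.prod_le_prod' fun i _ => uniformLaw_bin_inter_le (hs i) (hε i) (hhi i) _ _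

/-- A guess that depends on a vector of independent uniform variables only through its bins is
correct with probability at most the product of the relative tolerances. -/
theorem lintegral_guess_le (hs : ∀ i, 0 < s i) (hε : ∀ i, 0 < ε i)
    (hN : ∀ i, 0 < N i) (hhi : ∀ i, hi i = lo i + N i * s i)
    (A : (Fin d → ℤ) → Measure (Fin d → ℝ)) (hA : ∀ n, IsProbabilityMeasure (A n)) :
    ∫⁻ x, A (fun i => ⌊(x i - lo i) / s i⌋) {a | ∀ i, |a i - x i| ≤ ε i}
        ∂Measure.pi (fun i => uniformLaw (lo i) (hi i))
      ≤ ENNReal.ofReal (∏ i, 2 * ε i / s i) := by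
  have hlt : ∀ i, lo i < hi i := fun i => by
    have : (0 : ℝ) < N i := by exact_mod_cast hN i
    nlinarith [mul_pos this (hs i), hhi i]
  have := fun i => isProbabilityMeasure_uniformLaw (hlt i)
  set Q := Measure.pi (fun i => uniformLaw (lo i) (hi i)) with hQ
  set b : (Fin d → ℝ) → Fin d → ℤ := fun x i => ⌊(x i - lo i) / s i⌋ with hb
  have hbm : Measurable b := by rw [hb]; fun_prop
  set B : (Fin d → ℤ) → Set (Fin d → ℝ) := fun n => {x | b x = n} with hB
  have hBm : ∀ n, MeasurableSet (B n) := fun n => hbm (measurableSet_singleton n)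
  have hBU : (⋃ n, B n) = Set.univ := by ext x; simp [hB]
  have hS : MeasurableSet {z : (Fin d → ℝ) × (Fin d → ℝ) | ∀ i, |z.2 i - z.1 i| ≤ ε i} := by
    have : {z : (Fin d → ℝ) × (Fin d → ℝ) | ∀ i, |z.2 i - z.1 i| ≤ ε i}
        = ⋂ i, {z | |z.2 i - z.1 i| ≤ ε i} := by ext; simp
    rw [this]
    exact MeasurableSet.iInter fun i => measurableSet_le (by fun_prop) measurable_const
  have hfib : ∀ n, ∫⁻ x in B n, A (b x) {a | ∀ i, |a i - x i| ≤ ε i} ∂Q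
      ≤ ENNReal.ofReal (∏ i, 2 * ε i / s i) * Q (B n) := by
    intro n
    calc ∫⁻ x in B n, A (b x) {a | ∀ i, |a i - x i| ≤ ε i} ∂Q
        = ∫⁻ x in B n, A n {a | ∀ i, |a i - x i| ≤ ε i} ∂Q :=
          setLIntegral_congr_fun (hBm n) fun x hx => by
            have hx : b x = n := hx
            simp only [hx]
      _ = ((Q.restrict (B n)).prod (A n))
            {z : (Fin d → ℝ) × (Fin d → ℝ) | ∀ i, |z.2 i - z.1 i| ≤ ε i} :=
          (Measure.prod_apply hS).symm
      -- On a fixed bin the law of the guess no longer depends on `x`, so Fubini lets the guess be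
      -- frozen and `x` integrated first; randomization brings no gain.
      _ = ∫⁻ a, Q.restrict (B n) {x | ∀ i, |a i - x i| ≤ ε i} ∂A n :=
          Measure.prod_apply_symm hS
      _ ≤ ∫⁻ _, ENNReal.ofReal (∏ i, 2 * ε i / s i) * Q (B n) ∂A n := by
          refine lintegral_mono fun a => ?_
          rw [Measure.restrict_apply' (hBm n), Set.inter_comm]
          exact pi_uniformLaw_bin_inter_le hs hε hN hhi n a
      _ = ENNReal.ofReal (∏ i, 2 * ε i / s i) * Q (B n) := by simp
  calc ∫⁻ x, A (b x) {a | ∀ i, |a i - x i| ≤ ε i} ∂Q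
      = ∑' n, ∫⁻ x in B n, A (b x) {a | ∀ i, |a i - x i| ≤ ε i} ∂Q := by
        rw [← lintegral_iUnion hBm, hBU, Measure.restrict_univ]
        intro m n hmn
        refine Set.disjoint_left.2 fun x hx hx' => hmn ?_
        have hx : b x = m := hx
        exact hx.symm.trans hx'
    _ ≤ ∑' n, ENNReal.ofReal (∏ i, 2 * ε i / s i) * Q (B n ∩ Set.univ) :=
        ENNReal.tsum_le_tsum fun n => by simpa using hfib n
    _ = ENNReal.ofReal (∏ i, 2 * ε i / s i) := by
        rw [ENNReal.tsum_mul_left, tsum_measure_inter_fiber Q hbm, measure_univ, mul_one]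

end Bins

section Kernel

variable {k d : ℕ} {g : Fin d ↪ Fin k ⊕ Fin k} {ε s lo hi : Fin d → ℝ}

theorem measurableSet_guess (g : Fin d ↪ Fin k ⊕ Fin k) (ε : Fin d → ℝ) {α : Type*}
    [MeasurableSpace α] :
    MeasurableSet {z : (Param k × α) × (Fin d → ℝ) | ∀ i, |z.2 i - z.1.1 (g i)| ≤ ε i} := by
  have : {z : (Param k × α) × (Fin d → ℝ) | ∀ i, |z.2 i - z.1.1 (g i)| ≤ ε i}
      = ⋂ i, {z | |z.2 i - z.1.1 (g i)| ≤ ε i} := by ext; simp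
  rw [this]
  exact MeasurableSet.iInter fun i => measurableSet_le (by fun_prop) measurable_const

theorem compProd_guess (P : Measure (Param k)) [SFinite P] (M : Kernel (Param k) (Param k))
    [IsMarkovKernel M] (A : Kernel (Param k) (Fin d → ℝ)) [IsMarkovKernel A] :
    ((P ⊗ₘ M) ⊗ₘ A.prodMkLeft (Param k)) {z | ∀ i, |z.2 i - z.1.1 (g i)| ≤ ε i}
      = ∫⁻ θ, ∫⁻ θ', A θ' {a | ∀ i, |a i - θ (g i)| ≤ ε i} ∂M θ ∂P := by
  have hS := measurableSet_guess g ε (α := Param k)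
  rw [Measure.compProd_apply hS, Measure.lintegral_compProd]
  · rfl
  · exact Kernel.measurable_kernel_prodMk_left hS

theorem quantMechanism_apply (g : Fin d ↪ Fin k ⊕ Fin k) (lo : Fin d → ℝ) (hs : ∀ i, 0 < s i)
    (θ : Param k) : quantMechanism g lo s θ
      = (Measure.pi fun i => uniformLaw 0 (s i)).map (quantize g lo s θ) := by
  have := fun i => isProbabilityMeasure_uniformLaw (hs i)
  have hm := measurable_quantize g lo s
  rw [quantMechanism, Kernel.map_apply _ hm, Kernel.prod_apply, Kernel.id_apply,
    Kernel.const_apply, Measure.dirac_prod, Measure.map_map hm (by fun_prop)]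
  rfl

theorem isMarkovKernel_quantMechanism (g : Fin d ↪ Fin k ⊕ Fin k) (lo : Fin d → ℝ)
    (hs : ∀ i, 0 < s i) : IsMarkovKernel (quantMechanism g lo s) := by
  have := fun i => isProbabilityMeasure_uniformLaw (hs i)
  exact Kernel.IsMarkovKernel.map _ (measurable_quantize g lo s)

theorem measurable_quantize_right (g : Fin d ↪ Fin k ⊕ Fin k) (lo s : Fin d → ℝ) (θ : Param k) :
    Measurable (quantize g lo s θ) :=
  Measurable.of_uncurry_left (f := quantize g lo s) (measurable_quantize g lo s)

theorem measurable_guess_quantize (A : Kernel (Param k) (Fin d → ℝ)) [IsMarkovKernel A]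
    (g : Fin d ↪ Fin k ⊕ Fin k) (lo s ε : Fin d → ℝ) :
    Measurable fun z : Param k × (Fin d → ℝ) =>
      A (quantize g lo s z.1 z.2) {a | ∀ i, |a i - z.1 (g i)| ≤ ε i} :=
  Kernel.measurable_kernel_prodMk_left
    (κ := A.comap (fun z : Param k × (Fin d → ℝ) => quantize g lo s z.1 z.2)
      (measurable_quantize g lo s)) (measurableSet_guess g ε)

theorem lintegral_quantMechanism_guess (P : Measure (Param k)) (A : Kernel (Param k) (Fin d → ℝ))
    [IsMarkovKernel A] (hs : ∀ i, 0 < s i) :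
    ∫⁻ θ, ∫⁻ θ', A θ' {a | ∀ i, |a i - θ (g i)| ≤ ε i} ∂quantMechanism g lo s θ ∂P
      = ∫⁻ θ, ∫⁻ u, A (quantize g lo s θ u) {a | ∀ i, |a i - θ (g i)| ≤ ε i}
          ∂(Measure.pi fun i => uniformLaw 0 (s i)) ∂P := by
  refine lintegral_congr fun θ => ?_
  rw [quantMechanism_apply g lo hs, lintegral_map _ (measurable_quantize_right g lo s θ)]
  refine Kernel.measurable_coe A ?_
  exact (measurableSet_guess g ε (α := Unit)).preimage
    (f := fun a => ((θ, ()), a)) (by fun_prop)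

/-- The parameter with secret coordinates `x` and non-secret coordinates `y`. -/
noncomputable def assemble (g : Fin d ↪ Fin k ⊕ Fin k) (x : Fin d → ℝ)
    (y : {j // j ∉ Set.range g} → ℝ) : Param k :=
  Function.extend g x (Function.extend Subtype.val y 0)

theorem assemble_secret (x : Fin d → ℝ) (y : {j // j ∉ Set.range g} → ℝ) (i : Fin d) :
    assemble g x y (g i) = x i := by
  simp [assemble, g.injective.extend_apply]

theorem assemble_self (θ : Param k) :
    assemble g (fun i => θ (g i)) (fun j => θ j) = θ := by
  ext c
  by_cases hc : ∃ i, g i = c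
  · obtain ⟨i, rfl⟩ := hc
    exact assemble_secret _ _ i
  · rw [assemble, Function.extend_apply' _ _ _ hc]
    exact Subtype.val_injective.extend_apply
      (fun j : {j // j ∉ Set.range g} => θ j) 0 ⟨c, hc⟩

theorem measurable_assemble (g : Fin d ↪ Fin k ⊕ Fin k) :
    Measurable fun z : (Fin d → ℝ) × ({j // j ∉ Set.range g} → ℝ) => assemble g z.1 z.2 := by
  refine measurable_pi_iff.2 fun c => ?_
  by_cases hc : ∃ i, g i = c
  · obtain ⟨i, rfl⟩ := hc
    simp only [assemble_secret]
    fun_prop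
  · have : ∀ z : (Fin d → ℝ) × ({j // j ∉ Set.range g} → ℝ),
        assemble g z.1 z.2 c = z.2 ⟨c, hc⟩ := fun z => by
      rw [assemble, Function.extend_apply' _ _ _ hc]
      exact Subtype.val_injective.extend_apply z.2 0 ⟨c, hc⟩
    simp only [this]
    fun_prop

/-- Isolates the key structure: for fixed `u` and `y`, the release is a function of the bins of `x`
alone, as `lintegral_guess_le` requires. -/
theorem quantize_assemble (x u : Fin d → ℝ) (y : {j // j ∉ Set.range g} → ℝ) :
    quantize g lo s (assemble g x y) u
      = assemble g (fun i => lo i + ⌊(x i - lo i) / s i⌋ * s i + u i) y := by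
  ext c
  by_cases hc : ∃ i, g i = c
  · obtain ⟨i, rfl⟩ := hc
    simp [quantize, assemble, g.injective.extend_apply]
  · simp [quantize, assemble, Function.extend_apply' _ _ _ hc]

theorem map_secrets_eq_pi {P : Measure (Param k)} [IsProbabilityMeasure P]
    (hunif : ∀ i, P.map (fun θ => θ (g i)) = uniformLaw (lo i) (hi i))
    (hind : iIndepFun (fun (i : Fin d) (θ : Param k) => θ (g i)) P) :
    P.map (fun θ i => θ (g i)) = Measure.pi fun i => uniformLaw (lo i) (hi i) := by
  rw [(iIndepFun_iff_map_fun_eq_pi_map fun i => Measurable.aemeasurable (by fun_prop)).1 hind]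
  simp_rw [hunif]

theorem interPrivacy_quantMechanism_le {P : Measure (Param k)} [IsProbabilityMeasure P]
    {N : Fin d → ℕ} (hs : ∀ i, 0 < s i) (hε : ∀ i, 0 < ε i)
    (hN : ∀ i, 0 < N i) (hhi : ∀ i, hi i = lo i + N i * s i)
    (hunif : ∀ i, P.map (fun θ => θ (g i)) = uniformLaw (lo i) (hi i))
    (hind : iIndepFun (fun (i : Fin d) (θ : Param k) => θ (g i)) P)
    (hind' : IndepFun (fun (θ : Param k) (i : Fin d) => θ (g i))
      (fun (θ : Param k) (j : {j // j ∉ Set.range g}) => θ j) P) :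
    interPrivacy P g ε (quantMechanism g lo s) ≤ ENNReal.ofReal (∏ i, 2 * ε i / s i) := by
  have hlt : ∀ i, lo i < hi i := fun i => by
    have : (0 : ℝ) < N i := by exact_mod_cast hN i
    nlinarith [mul_pos this (hs i), hhi i]
  have := fun i => isProbabilityMeasure_uniformLaw (hlt i)
  have := fun i => isProbabilityMeasure_uniformLaw (hs i)
  have := isMarkovKernel_quantMechanism g lo hs
  refine iSup₂_le fun A hA => ?_
  -- Swapping the integrals puts the noise outside, so that the bound can be proved for each fixed
  -- `u`.
  rw [compProd_guess, lintegral_quantMechanism_guess P A hs,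
    lintegral_lintegral_swap (measurable_guess_quantize A g lo s ε).aemeasurable]
  set K := ENNReal.ofReal (∏ i, 2 * ε i / s i) with hK
  set Py := P.map (fun (θ : Param k) (j : {j // j ∉ Set.range g}) => θ j) with hPy
  have hPy1 : IsProbabilityMeasure Py := Measure.isProbabilityMeasure_map
    (Measurable.aemeasurable (by fun_prop))
  have hjoint : P.map (fun θ => ((fun i => θ (g i)), fun j : {j // j ∉ Set.range g} => θ j))
      = (Measure.pi fun i => uniformLaw (lo i) (hi i)).prod Py := by
    rw [(indepFun_iff_map_prod_eq_prod_map_map (Measurable.aemeasurable (by fun_prop))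
      (Measurable.aemeasurable (by fun_prop))).1 hind',
      map_secrets_eq_pi hunif hind]
  calc _ ≤ ∫⁻ _, K ∂(Measure.pi fun i => uniformLaw 0 (s i)) := lintegral_mono fun u => ?_
    _ = K := by simp
  set F : Param k → ℝ≥0∞ := fun θ =>
    A (quantize g lo s θ u) {a | ∀ i, |a i - θ (g i)| ≤ ε i} with hF
  have hFm : Measurable F := Measurable.of_uncurry_right
    (f := fun (θ : Param k) (u : Fin d → ℝ) =>
      A (quantize g lo s θ u) {a | ∀ i, |a i - θ (g i)| ≤ ε i})
    (measurable_guess_quantize A g lo s ε)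
  have hFa : Measurable fun z : (Fin d → ℝ) × ({j // j ∉ Set.range g} → ℝ) =>
      F (assemble g z.1 z.2) := hFm.comp (measurable_assemble g)
  calc ∫⁻ θ, F θ ∂P
      = ∫⁻ z, F (assemble g z.1 z.2)
          ∂P.map (fun θ => ((fun i => θ (g i)), fun j : {j // j ∉ Set.range g} => θ j)) := by
        rw [lintegral_map hFa (by fun_prop)]
        simp only [assemble_self]
    _ = ∫⁻ y, ∫⁻ x, F (assemble g x y) ∂(Measure.pi fun i => uniformLaw (lo i) (hi i)) ∂Py := by
        rw [hjoint, lintegral_prod_symm _ hFa.aemeasurable]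
    _ ≤ ∫⁻ _, K ∂Py := by
        refine lintegral_mono fun y => ?_
        simp only [hF, quantize_assemble, assemble_secret]
        exact lintegral_guess_le hs hε hN hhi
          (fun n => A (assemble g (fun i => lo i + n i * s i + u i) y)) fun n => inferInstance
    _ = K := by simp

/-- Noise shorter than a bin leaves the bin index readable from the release. -/
theorem floor_bin_add {lo s u : ℝ} (hs : 0 < s) (hu : u ∈ Set.Ico 0 s) (n : ℤ) :
    ⌊(lo + n * s + u - lo) / s⌋ = n := by
  have : lo + n * s + u ∈ {x : ℝ | ⌊(x - lo) / s⌋ = n} := by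
    rw [setOf_floor_eq hs]
    exact ⟨by linarith [hu.1], by linarith [hu.2]⟩
  exact this

theorem ae_pi_uniformLaw_mem_Ico (hs : ∀ i, 0 < s i) :
    ∀ᵐ u ∂(Measure.pi fun i => uniformLaw 0 (s i)), ∀ i, u i ∈ Set.Ico 0 (s i) := by
  have := fun i => isProbabilityMeasure_uniformLaw (hs i)
  exact Filter.eventually_all.2 fun i =>
    Measure.tendsto_eval_ae_ae.eventually ae_uniformLaw_mem_Ico

theorem quantize_secret (θ : Param k) (u : Fin d → ℝ) (i : Fin d) :
    quantize g lo s θ u (g i) = lo i + ⌊(θ (g i) - lo i) / s i⌋ * s i + u i := by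
  simp [quantize, g.injective.extend_apply]

theorem quantize_of_notMem_range (θ : Param k) (u : Fin d → ℝ) {c : Fin k ⊕ Fin k}
    (hc : c ∉ Set.range g) : quantize g lo s θ u c = θ c := by
  rw [quantize, Function.extend_apply' _ _ _ hc]

theorem le_interPrivacy_quantMechanism {P : Measure (Param k)} [IsProbabilityMeasure P]
    {N : Fin d → ℕ} (hs : ∀ i, 0 < s i) (hε : ∀ i, 0 < ε i) (hεs : ∀ i, 2 * ε i ≤ s i)
    (hN : ∀ i, 0 < N i) (hhi : ∀ i, hi i = lo i + N i * s i)
    (hunif : ∀ i, P.map (fun θ => θ (g i)) = uniformLaw (lo i) (hi i))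
    (hind : iIndepFun (fun (i : Fin d) (θ : Param k) => θ (g i)) P) :
    ENNReal.ofReal (∏ i, 2 * ε i / s i) ≤ interPrivacy P g ε (quantMechanism g lo s) := by
  have hlt : ∀ i, lo i < hi i := fun i => by
    have : (0 : ℝ) < N i := by exact_mod_cast hN i
    nlinarith [mul_pos this (hs i), hhi i]
  have := fun i => isProbabilityMeasure_uniformLaw (hlt i)
  have := fun i => isProbabilityMeasure_uniformLaw (hs i)
  have := isMarkovKernel_quantMechanism g lo hs
  have hcm : Measurable fun (θ : Param k) (i : Fin d) =>
      lo i + (⌊(θ (g i) - lo i) / s i⌋ + 1 / 2) * s i := by fun_prop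
  -- The optimal attacker recovers each bin from the released value and answers its midpoint.
  refine le_iSup₂_of_le (Kernel.deterministic _ hcm) inferInstance ?_
  rw [compProd_guess, lintegral_quantMechanism_guess P _ hs]
  set E : Set (Fin d → ℝ) := Set.univ.pi fun i =>
    {x | |lo i + (⌊(x - lo i) / s i⌋ + 1 / 2) * s i - x| ≤ ε i} with hE
  have hEm : MeasurableSet E := MeasurableSet.univ_pi fun i =>
    measurableSet_le (by fun_prop) measurable_const
  have hxm : Measurable fun (θ : Param k) (i : Fin d) => θ (g i) := by fun_prop
  calc ENNReal.ofReal (∏ i, 2 * ε i / s i)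
      = ∏ i, ENNReal.ofReal (2 * ε i / s i) :=
        ENNReal.ofReal_prod_of_nonneg fun i _ => by have := hs i; have := hε i; positivity
    _ ≤ Measure.pi (fun i => uniformLaw (lo i) (hi i)) E := by
        rw [hE, Measure.pi_pi]
        exact Finset.prod_le_prod' fun i _ =>
          le_uniformLaw_center (hs i) (hε i) (hεs i) (hN i) (hhi i)
    _ = P ((fun θ i => θ (g i)) ⁻¹' E) := by
        rw [← map_secrets_eq_pi hunif hind, Measure.map_apply hxm hEm]
    _ = ∫⁻ θ, ((fun (θ : Param k) i => θ (g i)) ⁻¹' E).indicator 1 θ ∂P :=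
        (lintegral_indicator_one (hxm hEm)).symm
    _ ≤ _ := by
        refine lintegral_mono fun θ => ?_
        by_cases hθ : θ ∈ (fun (θ : Param k) i => θ (g i)) ⁻¹' E
        swap
        · rw [Set.indicator_of_notMem hθ]
          exact zero_le
        rw [Set.indicator_of_mem hθ]
        have hθ : ∀ i, |lo i + (⌊(θ (g i) - lo i) / s i⌋ + 1 / 2) * s i - θ (g i)| ≤ ε i :=
          fun i => hθ i (Set.mem_univ i)
        calc (1 : Param k → ℝ≥0∞) θ = ∫⁻ _, 1 ∂(Measure.pi fun i => uniformLaw 0 (s i)) := by simp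
          _ ≤ _ := by
            refine lintegral_mono_ae ?_
            filter_upwards [ae_pi_uniformLaw_mem_Ico hs] with u hu
            rw [Kernel.deterministic_apply, Measure.dirac_apply_of_mem]
            intro i
            beta_reduce
            rw [quantize_secret, floor_bin_add (hs i) (hu i)]
            exact hθ i

end Kernel

/-! ### Distortion of the quantization mechanism -/

section Distortion

variable {k d : ℕ} {g : Fin d ↪ Fin k ⊕ Fin k} {ε s lo hi : Fin d → ℝ}

theorem sum_secrets_sq_le (g : Fin d ↪ Fin k ⊕ Fin k) (f : Fin k ⊕ Fin k → ℝ) :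
    ∑ i, f (g i) ^ 2 ≤ ∑ c, f c ^ 2 := by
  calc ∑ i, f (g i) ^ 2 = ∑ c ∈ Finset.univ.map g, f c ^ 2 := by rw [Finset.sum_map]
    _ ≤ ∑ c, f c ^ 2 :=
      Finset.sum_le_sum_of_subset_of_nonneg (Finset.subset_univ _) fun _ _ _ => sq_nonneg _

/-- The constraints hold almost surely and, being non-strict, cut out a closed set, which therefore
contains the support. -/
theorem support_quantMechanism_subset (g : Fin d ↪ Fin k ⊕ Fin k) (lo : Fin d → ℝ)
    (hs : ∀ i, 0 < s i) (θ : Param k) :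
    (quantMechanism g lo s θ).support ⊆
      {θ' | (∀ i, |θ (g i) - θ' (g i)| ≤ s i) ∧ ∀ c, c ∉ Set.range g → θ c = θ' c} := by
  have hcl : IsClosed {θ' : Param k |
      (∀ i, |θ (g i) - θ' (g i)| ≤ s i) ∧ ∀ c, c ∉ Set.range g → θ c = θ' c} := by
    simp only [Set.ofPred_and, Set.ofPred_forall]
    refine IsClosed.inter (isClosed_iInter fun i => isClosed_le (by fun_prop) (by fun_prop))
      (isClosed_iInter fun c => isClosed_iInter fun _ => isClosed_eq (by fun_prop) (by fun_prop))
  refine Measure.support_subset_of_isClosed hcl ?_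
  rw [quantMechanism_apply g lo hs]
  refine (ae_map_iff (measurable_quantize_right g lo s θ).aemeasurable hcl.measurableSet).2 ?_
  filter_upwards [ae_pi_uniformLaw_mem_Ico hs] with u hu
  refine ⟨fun i => ?_, fun c hc => (quantize_of_notMem_range θ u hc).symm⟩
  rw [quantize_secret]
  have hθ : θ (g i) ∈ {x : ℝ | ⌊(x - lo i) / s i⌋ = ⌊(θ (g i) - lo i) / s i⌋} := rfl
  rw [setOf_floor_eq (hs i)] at hθ
  rw [abs_le]
  exact ⟨by linarith [hθ.1, (hu i).2], by linarith [hθ.2, (hu i).1]⟩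

theorem distortion_quantMechanism_le (P : Measure (Param k)) (hs : ∀ i, 0 < s i) :
    distortion P (quantMechanism g lo s) ≤ ENNReal.ofReal (√(∑ i, s i ^ 2)) := by
  refine iSup₂_le fun θ _ => iSup₂_le fun θ' hθ' => ?_
  obtain ⟨h1, h2⟩ := support_quantMechanism_subset g lo hs θ hθ'
  rw [wasserstein2_gaussianLaw]
  refine ENNReal.ofReal_le_ofReal (Real.sqrt_le_sqrt ?_)
  calc ∑ c, (absDev θ c - absDev θ' c) ^ 2
      ≤ ∑ c, (θ c - θ' c) ^ 2 :=
        Finset.sum_le_sum fun c _ => sq_le_sq.2 (abs_absDev_sub_le θ θ' c)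
    _ = ∑ i, (θ (g i) - θ' (g i)) ^ 2 :=
        (Fintype.sum_of_injective g g.injective _ _ (fun c hc => by simp [h2 c hc])
          fun _ => rfl).symm
    _ ≤ ∑ i, s i ^ 2 := Finset.sum_le_sum fun i _ =>
        sq_le_sq.2 ((h1 i).trans (le_abs_self _))

theorem absDev_eq_self {θ : Param k} {c : Fin k ⊕ Fin k}
    (h : ∀ j, c = Sum.inr j → 0 ≤ θ c) : absDev θ c = θ c := by
  rcases c with j | j
  · rfl
  · exact abs_of_nonneg (h j rfl)

theorem wasserstein2_le_distortion {P : Measure (Param k)} {M : Kernel (Param k) (Param k)}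
    {θ θ' : Param k} (hθ : θ ∈ P.support) (hθ' : θ' ∈ (M θ).support) :
    wasserstein2 (gaussianLaw θ) (gaussianLaw θ') ≤ distortion P M :=
  le_iSup₂_of_le θ hθ (le_iSup₂_of_le θ' hθ' le_rfl)

/-- Near-extremal points are found inside boxes of positive measure, since almost every point of
such a box lies in the support. Each secret is within `t * s i` of `lo i` and each noise within `t *
s i` of `s i`, which costs the factor `1 - 2 * t`. -/
theorem le_distortion_quantMechanism_of_pos {P : Measure (Param k)} [IsProbabilityMeasure P]
    {N : Fin d → ℕ} (hs : ∀ i, 0 < s i)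
    (hN : ∀ i, 0 < N i) (hhi : ∀ i, hi i = lo i + N i * s i)
    (hnonneg : ∀ j, ∀ᵐ θ ∂P, 0 ≤ θ (Sum.inr j))
    (hunif : ∀ i, P.map (fun θ => θ (g i)) = uniformLaw (lo i) (hi i))
    (hind : iIndepFun (fun (i : Fin d) (θ : Param k) => θ (g i)) P)
    {t : ℝ} (ht : 0 < t) (ht' : t ≤ 1 / 4) :
    ENNReal.ofReal ((1 - 2 * t) * √(∑ i, s i ^ 2))
      ≤ distortion P (quantMechanism g lo s) := by
  have hle : ∀ i, lo i + s i ≤ hi i := fun i => by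
    have : (1 : ℝ) ≤ N i := by exact_mod_cast hN i
    nlinarith [mul_le_mul_of_nonneg_right this (hs i).le, hhi i]
  have := fun i => isProbabilityMeasure_uniformLaw (show lo i < hi i by linarith [hle i, hs i])
  have := fun i => isProbabilityMeasure_uniformLaw (hs i)
  have hts : ∀ i, 0 < t * s i := fun i => mul_pos ht (hs i)
  have hts' : ∀ i, t * s i ≤ 1 / 4 * s i := fun i => mul_le_mul_of_nonneg_right ht' (hs i).le
  have hθ : ∃ θ ∈ P.support, (∀ j, 0 ≤ θ (Sum.inr j)) ∧
      ∀ i, θ (g i) ∈ Set.Icc (lo i) (lo i + t * s i) := by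
    have hbox : MeasurableSet (Set.univ.pi fun i => Set.Icc (lo i) (lo i + t * s i)) :=
      MeasurableSet.univ_pi fun i => measurableSet_Icc
    have hpos : P ((fun θ i => θ (g i)) ⁻¹'
        Set.univ.pi fun i => Set.Icc (lo i) (lo i + t * s i)) ≠ 0 := by
      rw [← Measure.map_apply (by fun_prop) hbox, map_secrets_eq_pi hunif hind, Measure.pi_pi,
        Finset.prod_ne_zero_iff]
      intro i _
      exact (uniformLaw_Icc_pos le_rfl (by linarith [hts i])
        (by linarith [hts' i, hle i, hs i])).ne'
    have hfreq := frequently_ae_mem_iff.2 hpos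
    obtain ⟨θ, ⟨h1, h2⟩, h3⟩ := ((hfreq.and_eventually
      (Filter.eventually_all.2 hnonneg)).and_eventually (Measure.support_mem_ae (μ := P))).exists
    exact ⟨θ, h3, h2, fun i => h1 i (Set.mem_univ i)⟩
  obtain ⟨θ, hθP, hσ, hθ⟩ := hθ
  have hu : ∃ u : Fin d → ℝ, quantize g lo s θ u ∈ (quantMechanism g lo s θ).support ∧
      ∀ i, u i ∈ Set.Icc (s i - t * s i) (s i) := by
    have hpos : (Measure.pi fun i => uniformLaw 0 (s i))
        (Set.univ.pi fun i => Set.Icc (s i - t * s i) (s i)) ≠ 0 := by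
      rw [Measure.pi_pi, Finset.prod_ne_zero_iff]
      intro i _
      exact (uniformLaw_Icc_pos (by linarith [hts' i, hs i]) (by linarith [hts i]) le_rfl).ne'
    have hsupp : ∀ᵐ u ∂(Measure.pi fun i => uniformLaw 0 (s i)),
        quantize g lo s θ u ∈ (quantMechanism g lo s θ).support := by
      rw [quantMechanism_apply g lo hs]
      have h : ∀ᵐ θ' ∂(Measure.pi fun i => uniformLaw 0 (s i)).map (quantize g lo s θ),
          θ' ∈ ((Measure.pi fun i => uniformLaw 0 (s i)).map (quantize g lo s θ)).support :=
        Measure.support_mem_ae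
      exact ae_of_ae_map (measurable_quantize_right g lo s θ).aemeasurable h
    obtain ⟨u, h1, h2⟩ := ((frequently_ae_mem_iff.2 hpos).and_eventually hsupp).exists
    exact ⟨u, h2, fun i => h1 i (Set.mem_univ i)⟩
  obtain ⟨u, huM, hu⟩ := hu
  refine le_trans ?_ (wasserstein2_le_distortion hθP huM)
  rw [wasserstein2_gaussianLaw]
  have h2t : 0 ≤ 1 - 2 * t := by linarith
  refine ENNReal.ofReal_le_ofReal ?_
  rw [← Real.sqrt_sq h2t, ← Real.sqrt_mul (sq_nonneg _), Finset.mul_sum]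
  refine Real.sqrt_le_sqrt (le_trans (Finset.sum_le_sum fun i _ => ?_)
    (sum_secrets_sq_le g fun c => absDev θ c - absDev (quantize g lo s θ u) c))
  -- `t ≤ 1 / 4` keeps the secret strictly inside the first bin.
  have hfl : ⌊(θ (g i) - lo i) / s i⌋ = 0 := by
    have : θ (g i) ∈ {x : ℝ | ⌊(x - lo i) / s i⌋ = 0} := by
      rw [setOf_floor_eq (hs i)]
      push_cast
      exact ⟨by linarith [(hθ i).1], by linarith [(hθ i).2, hts' i, hs i]⟩
    exact this
  have hq : quantize g lo s θ u (g i) = lo i + u i := by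
    rw [quantize_secret, hfl]; simp
  have hge : (1 - 2 * t) * s i ≤ quantize g lo s θ u (g i) - θ (g i) := by
    rw [hq]; linarith [(hθ i).2, (hu i).1]
  have hge0 : 0 ≤ (1 - 2 * t) * s i := mul_nonneg h2t (hs i).le
  have hσi : ∀ j, g i = Sum.inr j → 0 ≤ θ (g i) := fun j hj => by rw [hj]; exact hσ j
  -- A released standard deviation exceeds the nonnegative original, so absolute values do not
  -- shrink the gap.
  rw [absDev_eq_self hσi, absDev_eq_self fun j hj => by linarith [hσi j hj], ← mul_pow]
  exact sq_le_sq.2 (by rw [abs_of_nonneg hge0, abs_sub_comm]; exact hge.trans (le_abs_self _))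

theorem le_distortion_quantMechanism {P : Measure (Param k)} [IsProbabilityMeasure P]
    {N : Fin d → ℕ} (hs : ∀ i, 0 < s i)
    (hN : ∀ i, 0 < N i) (hhi : ∀ i, hi i = lo i + N i * s i)
    (hnonneg : ∀ j, ∀ᵐ θ ∂P, 0 ≤ θ (Sum.inr j))
    (hunif : ∀ i, P.map (fun θ => θ (g i)) = uniformLaw (lo i) (hi i))
    (hind : iIndepFun (fun (i : Fin d) (θ : Param k) => θ (g i)) P) :
    ENNReal.ofReal (√(∑ i, s i ^ 2)) ≤ distortion P (quantMechanism g lo s) := by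
  have hlim : Filter.Tendsto (fun t : ℝ => ENNReal.ofReal ((1 - 2 * t) * √(∑ i, s i ^ 2)))
      (nhdsWithin 0 (Set.Ioi 0)) (nhds (ENNReal.ofReal (√(∑ i, s i ^ 2)))) := by
    have hc : Continuous fun t : ℝ => ENNReal.ofReal ((1 - 2 * t) * √(∑ i, s i ^ 2)) :=
      ENNReal.continuous_ofReal.comp (by fun_prop)
    have := hc.tendsto 0
    simp only [mul_zero, sub_zero, one_mul] at this
    exact this.mono_left nhdsWithin_le_nhds
  refine le_of_tendsto hlim ?_
  filter_upwards [Ioc_mem_nhdsGT (show (0 : ℝ) < 1 / 4 by norm_num)] with t ht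
  exact le_distortion_quantMechanism_of_pos hs hN hhi hnonneg hunif hind ht.1 ht.2

end Distortion

/-! ### Lower bound on the optimal distortion -/

theorem measurable_absDev {k : ℕ} : Measurable (absDev (k := k)) := by
  refine measurable_pi_iff.2 fun c => ?_
  rcases c with j | j
  · exact measurable_pi_apply _
  · exact (measurable_pi_apply (Sum.inr j : Fin k ⊕ Fin k)).abs

/-- A mechanism with distortion below all the tolerances has no privacy: the released parameters
are themselves good enough guesses. -/
theorem one_le_interPrivacy_of_distortion_lt {k d : ℕ} {g : Fin d ↪ Fin k ⊕ Fin k}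
    {ε : Fin d → ℝ} {P : Measure (Param k)} [IsProbabilityMeasure P]
    (hnonneg : ∀ j, ∀ᵐ θ ∂P, 0 ≤ θ (Sum.inr j)) {M : Kernel (Param k) (Param k)}
    [IsMarkovKernel M] {e : ℝ} (he : 0 < e) (heε : ∀ i, e ≤ ε i)
    (hM : distortion P M < ENNReal.ofReal e) : 1 ≤ interPrivacy P g ε M := by
  -- An arbitrary mechanism may release negative standard deviations, and `W₂` sees only their
  -- absolute values, so those are what the attacker reports.
  have hcm : Measurable fun (θ : Param k) (i : Fin d) => absDev θ (g i) :=
    measurable_pi_iff.2 fun i => (measurable_pi_apply (g i)).comp measurable_absDev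
  refine le_iSup₂_of_le (Kernel.deterministic _ hcm) inferInstance ?_
  rw [compProd_guess]
  calc (1 : ℝ≥0∞) = ∫⁻ θ, ∫⁻ _, 1 ∂M θ ∂P := by simp
    _ ≤ _ := by
      refine lintegral_mono_ae ?_
      filter_upwards [Filter.eventually_all.2 hnonneg, Measure.support_mem_ae (μ := P)]
        with θ hσ hθ
      refine lintegral_mono_ae ?_
      -- Almost every pair lies in the supports, so the worst-case distance bounds it.
      filter_upwards [Measure.support_mem_ae (μ := M θ)] with θ' hθ'
      rw [Kernel.deterministic_apply, Measure.dirac_apply_of_mem]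
      intro i
      beta_reduce
      have hW := (wasserstein2_le_distortion hθ hθ').trans_lt hM
      rw [wasserstein2_gaussianLaw, ENNReal.ofReal_lt_ofReal_iff he] at hW
      have hi : absDev θ (g i) = θ (g i) := absDev_eq_self fun j hj => by rw [hj]; exact hσ j
      rw [abs_sub_comm, ← hi]
      refine (Real.abs_le_sqrt ?_).trans (hW.le.trans (heε i))
      exact Finset.single_le_sum (f := fun c => (absDev θ c - absDev θ' c) ^ 2)
        (fun _ _ => sq_nonneg _) (Finset.mem_univ (g i))

theorem le_optDistortion {k d : ℕ} {g : Fin d ↪ Fin k ⊕ Fin k}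
    {ε : Fin d → ℝ} {P : Measure (Param k)} [IsProbabilityMeasure P]
    (hnonneg : ∀ j, ∀ᵐ θ ∂P, 0 ≤ θ (Sum.inr j)) {e : ℝ} (he : 0 < e) (heε : ∀ i, e ≤ ε i)
    {T : ℝ≥0∞} (hT : T < 1) : ENNReal.ofReal e ≤ optDistortion P g ε T := by
  refine le_iInf fun M => le_iInf fun _ => le_iInf fun hMT => ?_
  by_contra! hlt
  exact (hMT.trans_lt hT).not_ge (one_le_interPrivacy_of_distortion_lt hnonneg he heε hlt)

theorem exists_pos_le_all {d : ℕ} {ε : Fin d → ℝ} (hε : ∀ i, 0 < ε i) :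
    ∃ e : ℝ, 0 < e ∧ ∀ i, e ≤ ε i := by
  rcases isEmpty_or_nonempty (Fin d) with h | h
  -- With no secrets any positive value serves: the empty product is `1`, so the optimality claim is
  -- vacuous.
  · exact ⟨1, one_pos, fun i => h.elim i⟩
  · obtain ⟨i₀, hi₀⟩ := Finite.exists_min ε
    exact ⟨ε i₀, hε i₀, hi₀⟩

end SummaryPrivacy

theorem mainTheorem11 {d : ℕ} (ε s : Fin d → ℝ) (hε : ∀ i, 0 < ε i)
    (hs : ∀ i, 2 * ε i ≤ s i) :
    ∃ c : ℝ, 0 < c ∧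
      ∀ (k : ℕ) (g : Fin d ↪ Fin k ⊕ Fin k) (lo hi : Fin d → ℝ)
        (P : Measure (SummaryPrivacy.Param k)),
        -- the bins of length `s i` partition the range of the `i`-th secret
        (∀ i, ∃ N : ℕ, 0 < N ∧ hi i = lo i + N * s i) →
        IsProbabilityMeasure P →
        -- standard deviations are nonnegative
        (∀ j, ∀ᵐ θ ∂P, 0 ≤ θ (Sum.inr j)) →
        -- the secret parameters are uniform, mutually independent,
        -- and independent of the non-secret parameters
        (∀ i, P.map (fun θ => θ (g i)) = SummaryPrivacy.uniformLaw (lo i) (hi i)) →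
        iIndepFun (fun (i : Fin d) (θ : SummaryPrivacy.Param k) => θ (g i)) P →
        IndepFun (fun (θ : SummaryPrivacy.Param k) (i : Fin d) => θ (g i))
          (fun (θ : SummaryPrivacy.Param k) (j : {j // j ∉ Set.range g}) => θ j) P →
        SummaryPrivacy.interPrivacy P g ε (SummaryPrivacy.quantMechanism g lo s)
            = ENNReal.ofReal (∏ i, 2 * ε i / s i) ∧
        SummaryPrivacy.distortion P (SummaryPrivacy.quantMechanism g lo s)
            = ENNReal.ofReal (√(∑ i, s i ^ 2)) ∧
        (∏ i, 2 * ε i / s i < 1 →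
          SummaryPrivacy.distortion P (SummaryPrivacy.quantMechanism g lo s)
            < ENNReal.ofReal c * SummaryPrivacy.optDistortion P g ε
                (SummaryPrivacy.interPrivacy P g ε (SummaryPrivacy.quantMechanism g lo s))) := by
  have hs0 : ∀ i, 0 < s i := fun i => by linarith [hs i, hε i]
  obtain ⟨e, he, heε⟩ := SummaryPrivacy.exists_pos_le_all hε
  -- The quotient alone gives the non-strict comparison with the lower bound `e`; the extra `1` adds
  -- `e` and makes it strict.
  have hc : 0 < √(∑ i, s i ^ 2) / e + 1 := by positivity
  refine ⟨√(∑ i, s i ^ 2) / e + 1, hc, ?_⟩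
  intro k g lo hi P hbins hP hnonneg hunif hind hind'
  choose N hN hhi using hbins
  have hpriv := le_antisymm
    (SummaryPrivacy.interPrivacy_quantMechanism_le hs0 hε hN hhi hunif hind hind')
    (SummaryPrivacy.le_interPrivacy_quantMechanism hs0 hε hs hN hhi hunif hind)
  have hdist := le_antisymm (SummaryPrivacy.distortion_quantMechanism_le P hs0)
    (SummaryPrivacy.le_distortion_quantMechanism hs0 hN hhi hnonneg hunif hind)
  refine ⟨hpriv, hdist, fun hlt => ?_⟩
  rw [hdist, hpriv]
  have hopt := SummaryPrivacy.le_optDistortion (g := g) hnonneg he heε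
    (ENNReal.ofReal_lt_one.2 hlt)
  refine lt_of_lt_of_le ?_ (mul_le_mul_right hopt _)
  rw [← ENNReal.ofReal_mul hc.le, ENNReal.ofReal_lt_ofReal_iff (by positivity), add_mul,
    div_mul_cancel₀ _ he.ne']
  linarith
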